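/- Let $d\ge 1$ and let $\delta$ be the Euclidean distance on $E^d=\mathbb R^d$. For a finite set $S\subset E^d$ and an angle $0\le\alpha\le 60^\circ$, the Satellite System Graph (SSG) of $S$ is the directed graph on $S$ in which, for $p\ne q$ in $S$, the edge $\overrightarrow{pq}$ is present if and only if no point $r\in S$ with $\angle rpq<\alpha$ and $\delta(p,r)<\delta(p,q)$ is an out-neighbour of $p$. Let $D_S$ be the maximal out-degree of the SSG of $S$, and let $\Delta r$ be the minimum of $|\delta(a,b)-\delta(a,c)|$ over all non-isosceles triangles $abc$ with vertices in $S$. Greedy search for $q$ with candidate pool size $l\ge1$ works as follows. The pool initially holds only the start node. As long as the pool has an unchecked node, the unchecked node of the pool closest to $q$ is checked: its not yet visited out-neighbours are put into the pool, which is then cut down to its $l$ nodes closest to $q$. The answer is the node of the final pool closest to $q$. The complexity of a search is the number of operations, where the evaluation of the distance of the start node to $q$, each iteration, and each inspection of an out-neighbour in an iteration (including the evaluation of its distance to $q$, if needed) count as one operation. Let $S=\{X_1,\dots,X_n\}$ consist of $n\ge3$ random points whose joint law has a probability density (for instance, independent points with densities) and which lie almost surely in a bounded region $\Omega\subset E^d$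 with $\mathrm{vol}(B(0,\mathrm{diam}\,\Omega))\le\kappa\,\mathrm{vol}(\Omega)$ and $n\ge g\,\mathrm{vol}(\Omega)$, for constants $\kappa,g>0$ (the region is not too thin, and the mean number of points per unit volume is bounded below). Then there are numbers $D(\alpha,d)$, depending only on $\alpha$ and $d$, and a constant $C$, depending only on $d,\kappa,g$, such that almost surely the following holds for every $0\le\alpha\le60^\circ$. If $\alpha>0$, then $D_S\le D(\alpha,d)$. For every indexed query $q\in S$ and every $l\ge1$, greedy search on the SSG from a start node chosen uniformly at random in $S$ stops with the answer $q$, and its expected complexity is at most $$C\cdot\frac{D_S\,n^{1/d}\log(n^{1/d})}{\Delta r};$$ the same bound holds for the complexity from every single start node in $S$. -/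

import Mathlib

open MeasureTheory

noncomputable section

/-- Euclidean space of dimension `d`. -/
abbrev Euc (d : ℕ) : Type := EuclideanSpace ℝ (Fin d)

/-! ### The Satellite System Graph -/

/-- The circular cone with apex `p` around the ray from `p` through `q`, of half-angle `α`
(angular diameter `2α`). -/
def circCone {d : ℕ} (p q : Euc d) (α : ℝ) : Set (Euc d) :=
  {x | EuclideanGeometry.angle x p q < α}

/-- `SSGAdj S α p q` : the directed edge from `p` to `q` belongs to the Satellite System Graph of
the finite point set `S` with angle `α`. The edge is kept iff no point of `S` which lies in the cone
around it, and is strictly closer to `p` than `q`, is itself an out-neighbour of `p`.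
The recursion is on the number of points of `S` closer to `p` than `q`. -/
def SSGAdj {d : ℕ} (S : Finset (Euc d)) (α : ℝ) (p q : Euc d) : Prop :=
  p ∈ S ∧ q ∈ S ∧ q ≠ p ∧
    ∀ r, ∀ _ : r ∈ S, r ∈ circCone p q α → ∀ _ : dist p r < dist p q, ¬ SSGAdj S α p r
termination_by (S.filter (fun x => dist p x < dist p q)).card
decreasing_by
  rename_i hr _ hlt
  refine Finset.card_lt_card ((Finset.ssubset_iff_of_subset ?_).2 ⟨r, ?_, ?_⟩)
  · intro x hx
    rw [Finset.mem_filter] at hx ⊢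
    exact ⟨hx.1, hx.2.trans hlt⟩
  · exact Finset.mem_filter.2 ⟨hr, hlt⟩
  · exact fun h => lt_irrefl _ (Finset.mem_filter.1 h).2

/-- The defining property of the Satellite System Graph: the edge from `p` to `q` is present iff the
cone around it, intersected with the open ball of radius `dist p q` at `p` and with `S`, is empty or
contains no out-neighbour of `p`. -/
theorem ssgAdj_iff {d : ℕ} (S : Finset (Euc d)) (α : ℝ) (p q : Euc d)
    (hp : p ∈ S) (hq : q ∈ S) (hpq : q ≠ p) :
    SSGAdj S α p q ↔
      (circCone p q α ∩ Metric.ball p (dist p q) ∩ (S : Set (Euc d)) = ∅ ∨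
        ∀ r ∈ circCone p q α ∩ Metric.ball p (dist p q) ∩ (S : Set (Euc d)),
          ¬ SSGAdj S α p r) := by
  have key : SSGAdj S α p q ↔
      ∀ r ∈ circCone p q α ∩ Metric.ball p (dist p q) ∩ (S : Set (Euc d)),
          ¬ SSGAdj S α p r := by
    rw [SSGAdj]
    constructor
    · rintro ⟨-, -, -, h⟩ r ⟨⟨h1, h2⟩, h3⟩
      exact h r h3 h1 (by rwa [Metric.mem_ball, dist_comm] at h2)
    · intro h
      refine ⟨hp, hq, hpq, fun r h3 h1 h2 => h r ⟨⟨h1, ?_⟩, h3⟩⟩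
      rwa [Metric.mem_ball, dist_comm]
  rw [key]
  constructor
  · exact Or.inr
  · rintro (h | h)
    · intro r hr
      rw [h] at hr
      exact hr.elim
    · exact h

open Classical in
/-- The out-degree of `p` in the Satellite System Graph of `S`. -/
def ssgOutDegree {d : ℕ} (S : Finset (Euc d)) (α : ℝ) (p : Euc d) : ℕ :=
  (S.filter (fun q => SSGAdj S α p q)).card

/-- The least upper bound of the out-degrees of the Satellite System Graph of `S`. -/
def ssgDegree {d : ℕ} (S : Finset (Euc d)) (α : ℝ) : ℕ :=
  S.sup (ssgOutDegree S α)

/-- `nbrs` stores the Satellite System Graph of `S` by adjacency lists: for every `p ∈ S`, the list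
`nbrs p` enumerates the out-neighbours of `p`, in some order and without repetition. -/
def IsSSGAdjacencyList {d : ℕ} (S : Finset (Euc d)) (α : ℝ) (nbrs : Euc d → List (Euc d)) : Prop :=
  ∀ p ∈ S, (nbrs p).Nodup ∧ ∀ r, r ∈ nbrs p ↔ SSGAdj S α p r

/-! ### Greedy search on a graph -/

/-- State of the search: the candidate pool, the nodes checked so far, the nodes visited so far
(those which have ever been put into the pool), and the work spent so far. -/
structure SearchState (V : Type) where
  pool : List V
  checked : Set V
  visited : Set V
  cost : ℕ

/-- The start: the pool holds just the start node, whose distance to the query costs one unit. -/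
def searchInit {V : Type} (start : V) : SearchState V where
  pool := [start]
  checked := ∅
  visited := {start}
  cost := 1

open Classical in
/-- One iteration of the search for the query `q` with candidate pool size `l` on the graph with
adjacency lists `nbrs`: check the first unchecked node `p` of the pool, add its unvisited
neighbours to the pool, sort the pool by the distance to `q` and cut it down to its first `l` nodes.
An iteration costs one unit plus one unit for each inspected neighbour (test whether it has been
visited, and if not, computation of its distance to `q`). If all nodes of the pool have been
checked, the search has stopped and the state does not change. -/
def searchStep {V : Type} [Dist V] (nbrs : V → List V) (q : V) (l : ℕ) (s : SearchState V) :
    SearchState V :=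
  match s.pool.find? (fun v => decide (v ∉ s.checked)) with
  | none => s
  | some p =>
    { pool := ((s.pool ++ (nbrs p).filter (fun v => decide (v ∉ s.visited))).insertionSort
        (fun a b => dist a q ≤ dist b q)).take l
      checked := insert p s.checked
      visited := s.visited ∪ {v | v ∈ nbrs p}
      cost := s.cost + 1 + (nbrs p).length }

/-- The state after `t` iterations. -/
def searchRun {V : Type} [Dist V] (nbrs : V → List V) (q : V) (l : ℕ) (start : V) (t : ℕ) :
    SearchState V :=
  (searchStep nbrs q l)^[t] (searchInit start)

/-- The search for `q` from `start` with pool size `l` stops, with `r` as the first node of the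
final pool (the answer for one nearest neighbour), and with total work `c`. -/
def SearchReturns {V : Type} [Dist V] (nbrs : V → List V) (q : V) (l : ℕ) (start : V)
    (r : V) (c : ℕ) : Prop :=
  ∃ t : ℕ, (∀ v ∈ (searchRun nbrs q l start t).pool, v ∈ (searchRun nbrs q l start t).checked) ∧
    (searchRun nbrs q l start t).pool.head? = some r ∧
    (searchRun nbrs q l start t).cost = c

/-! ### Length differences in triangles -/

/-- The lower bound `Δr` of the differences between the lengths of two edges of a non-isosceles
triangle with vertices in `S`. As the triangle `a, b, c` may be relabelled, the two edges at `a`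
stand for any two edges. -/
def triangleGap {d : ℕ} (S : Finset (Euc d)) : ℝ :=
  sInf {t | ∃ a ∈ S, ∃ b ∈ S, ∃ c ∈ S, a ≠ b ∧ a ≠ c ∧ b ≠ c ∧
    dist a b ≠ dist a c ∧ dist a b ≠ dist b c ∧ dist a c ≠ dist b c ∧
    t = |dist a b - dist a c|}

/-! ### Random data sets -/

/-- `μ` is the joint law of `n` points distributed randomly, with a joint probability density (for
instance independently, each with a density), in a bounded region `Ω`. The region is not too thin
(its volume is at least the fraction `1/κ` of the volume of a ball whose radius is the
diameter of `Ω`), and the mean number of points per unit volume is at least `g`. -/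
structure IsRandomDataset {d n : ℕ} (κ g : ℝ) (Ω : Set (Euc d)) (μ : Measure (Fin n → Euc d)) :
    Prop where
  isProbabilityMeasure : IsProbabilityMeasure μ
  absolutelyContinuous : μ ≪ volume
  ae_mem : ∀ᵐ x ∂μ, ∀ i, x i ∈ Ω
  isBounded : Bornology.IsBounded Ω
  volume_ball_le : volume (Metric.ball (0 : Euc d) (Metric.diam Ω)) ≤ ENNReal.ofReal κ * volume Ω
  density_le : ENNReal.ofReal g * volume Ω ≤ (n : ENNReal)

end

/-!
Two facts about the data set hold almost surely. Since spheres are null sets, no two distances from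
a common point coincide (`ae_dist_ne_dist`), and all points lie in `Ω`. The rest is
deterministic.

*Out-degree.* Of two out-neighbours of `p` at an angle below `α` the closer one would exclude the
other. Hence the directions of the out-neighbours are separated by `α`, and compactness of the
sphere bounds their number (`exists_ssgDegree_le`).

*Correctness.* If the edge from `p` to `q` is absent, there is an edge from `p` to some `r` with
`∠ r p q < 60°` and `dist p r < dist p q`, and then `dist r q < dist p q`
(`exists_ssgAdj_dist_lt`). In the search, the first node of the pool is always the visited
node closest to `q`. When the search stops, this node has been checked, so that its neighbours have
been visited and none of them is closer to `q`: the node is `q` (`exists_searchReturns`).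

*Complexity.* Every iteration checks a new node and costs at most `1 + D_S`, so that the total cost
is at most `1 + n * (1 + D_S)`, whatever `l` is; for `l ≥ n` the search may visit all nodes. This is
within the claimed bound because the gap is small: the `n - 1` distances from one point to the
others lie in `[0, diam Ω]` and differ pairwise by at least the gap, so that
`n * triangleGap S ≤ 3 * diam Ω` (`card_mul_triangleGap_le`), while the hypotheses on the volume of
`Ω` bound `diam Ω` by a multiple of `n ^ (1 / d)` (`IsRandomDataset.diam_le`).
-/

/-! ### Random points are in general position -/

/-- A measurable set in a product space is null if all its sections in one coordinate direction
are null. -/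
theorem volume_pi_eq_zero_of_update {ι E : Type*} [Fintype ι] [DecidableEq ι] [MeasureSpace E]
    [SigmaFinite (volume : Measure E)] (j : ι) {A : Set (ι → E)} (hA : MeasurableSet A)
    (h : ∀ x : ι → E, volume {y | Function.update x j y ∈ A} = 0) : volume A = 0 := by
  rw [← lintegral_indicator_one hA]
  have key : ∫⁻ x, A.indicator (1 : (ι → E) → ENNReal) x ∂(Measure.pi fun _ : ι => volume)
      = ∫⁻ _, 0 ∂(Measure.pi fun _ : ι => (volume : Measure E)) := by
    refine lintegral_eq_of_lmarginal_eq (μ := fun _ : ι => (volume : Measure E)) {j}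
      (measurable_one.indicator hA) measurable_const ?_
    funext x
    rw [lmarginal_singleton, lmarginal_singleton]
    have hm : MeasurableSet {y | Function.update x j y ∈ A} := measurable_update x hA
    have : ∀ y, A.indicator (1 : (ι → E) → ENNReal) (Function.update x j y)
        = {y | Function.update x j y ∈ A}.indicator (1 : E → ENNReal) y := fun y => rfl
    simp only [this]
    rw [lintegral_indicator_one hm, h x]
    simp
  rw [lintegral_zero] at key
  exact key

/-- Almost surely no point of the data set lies on a sphere around another one through a third one.
With `k = i` this says that the points are distinct. -/
theorem ae_dist_ne_dist {d n : ℕ} (hd : 0 < d) {μ : Measure (Fin n → Euc d)} (hμ : μ ≪ volume) :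
    ∀ᵐ x ∂μ, ∀ i j k : Fin n, j ≠ i → j ≠ k → dist (x i) (x j) ≠ dist (x i) (x k) := by
  have : Nonempty (Fin d) := ⟨⟨0, hd⟩⟩
  refine hμ.ae_le ?_
  change ∀ᵐ x : Fin n → Euc d, _
  simp only [ae_all_iff]
  intro i j k hji hjk
  rw [ae_iff]
  refine volume_pi_eq_zero_of_update j ?_ fun x => ?_
  · simp only [ne_eq, not_not]
    exact measurableSet_eq_fun (by fun_prop) (by fun_prop)
  · refine measure_mono_null ?_ (Measure.addHaar_sphere volume (x i) (dist (x i) (x k)))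
    intro y hy
    rw [Metric.mem_sphere, dist_comm]
    simpa [Function.update_of_ne hji.symm, Function.update_of_ne hjk.symm] using hy

/-! ### The Satellite System Graph -/

theorem ssgAdj_iff_forall {d : ℕ} {S : Finset (Euc d)} {α : ℝ} {p q : Euc d} :
    SSGAdj S α p q ↔ p ∈ S ∧ q ∈ S ∧ q ≠ p ∧
      ∀ r ∈ S, EuclideanGeometry.angle r p q < α → dist p r < dist p q → ¬ SSGAdj S α p r := by
  rw [SSGAdj]
  rfl

/-- In a triangle, the side opposite to an angle below `60°` is shorter than the longer one of the
two other sides. -/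
theorem dist_lt_dist_of_angle_lt {d : ℕ} {p q r : Euc d}
    (hangle : EuclideanGeometry.angle r p q < Real.pi / 3) (hr : 0 < dist p r)
    (hrq : dist p r < dist p q) : dist r q < dist p q := by
  have hcos : 1 / 2 < Real.cos (EuclideanGeometry.angle r p q) := by
    rw [← Real.cos_pi_div_three]
    exact Real.cos_lt_cos_of_nonneg_of_le_pi (EuclideanGeometry.angle_nonneg _ _ _)
      (by linarith [Real.pi_pos]) hangle
  have hlaw := EuclideanGeometry.law_cos r p q
  rw [dist_comm r p, dist_comm q p] at hlaw
  refine lt_of_pow_lt_pow_left₀ 2 dist_nonneg ?_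
  have hprod : 0 < dist p r * dist p q := mul_pos hr (hr.trans hrq)
  nlinarith [mul_lt_mul_of_pos_left hcos hprod]

/-- From every point other than the query there is an edge to a point closer to the query: either
the edge to the query itself, or the edge which excludes it. -/
theorem exists_ssgAdj_dist_lt {d : ℕ} {S : Finset (Euc d)} {α : ℝ} (hα : α ≤ Real.pi / 3)
    {p q : Euc d} (hp : p ∈ S) (hq : q ∈ S) (hpq : p ≠ q) :
    ∃ r, SSGAdj S α p r ∧ dist r q < dist p q := by
  by_cases h : SSGAdj S α p q
  · exact ⟨q, h, by simpa using hpq⟩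
  · rw [ssgAdj_iff_forall] at h
    push Not at h
    obtain ⟨r, -, hangle, hlt, hr⟩ := h hp hq hpq.symm
    have hrp : r ≠ p := (ssgAdj_iff_forall.1 hr).2.2.1
    exact ⟨r, hr, dist_lt_dist_of_angle_lt (hangle.trans_le hα) (dist_pos.2 hrp.symm) hlt⟩

theorem ssgOutDegree_le_ssgDegree {d : ℕ} {S : Finset (Euc d)} {α : ℝ} {p : Euc d} (hp : p ∈ S) :
    ssgOutDegree S α p ≤ ssgDegree S α :=
  Finset.le_sup (f := ssgOutDegree S α) hp

theorem one_le_ssgDegree {d : ℕ} {S : Finset (Euc d)} {α : ℝ} (hα : α ≤ Real.pi / 3)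
    (hS : 1 < S.card) : 1 ≤ ssgDegree S α := by
  classical
  obtain ⟨p, hp, q, hq, hpq⟩ := Finset.one_lt_card.1 hS
  obtain ⟨r, hr, -⟩ := exists_ssgAdj_dist_lt hα hp hq hpq
  refine le_trans (Finset.card_pos.2 ⟨r, ?_⟩) (ssgOutDegree_le_ssgDegree hp)
  exact Finset.mem_filter.2 ⟨(ssgAdj_iff_forall.1 hr).2.1, hr⟩

theorem IsSSGAdjacencyList.length_le {d : ℕ} {S : Finset (Euc d)} {α : ℝ}
    {nbrs : Euc d → List (Euc d)} (h : IsSSGAdjacencyList S α nbrs) {p : Euc d} (hp : p ∈ S) :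
    (nbrs p).length ≤ ssgDegree S α := by
  classical
  refine le_trans ?_ (ssgOutDegree_le_ssgDegree hp)
  rw [← List.toFinset_card_of_nodup (h p hp).1]
  refine Finset.card_le_card fun r hr => ?_
  have hadj := ((h p hp).2 r).1 (List.mem_toFinset.1 hr)
  exact Finset.mem_filter.2 ⟨(ssgAdj_iff_forall.1 hadj).2.1, hadj⟩

/-! ### Bounded out-degree -/

/-- There is a bound on the number of non-zero vectors with pairwise angles at least `α`: the unit
sphere is compact, hence covered by finitely many caps of angular radius `α / 2`, and each cap
contains the direction of at most one of the vectors. -/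
theorem exists_card_le_of_angle_le {V : Type*} [NormedAddCommGroup V] [InnerProductSpace ℝ V]
    [FiniteDimensional ℝ V] {α : ℝ} (hα : 0 < α) :
    ∃ N : ℕ, ∀ T : Finset V, (∀ v ∈ T, v ≠ 0) →
      (∀ v ∈ T, ∀ w ∈ T, v ≠ w → α ≤ InnerProductGeometry.angle v w) → T.card ≤ N := by
  classical
  obtain ⟨F, hF, hcover⟩ := (isCompact_sphere (0 : V) 1).elim_nhds_subcover
    (fun x => {y | InnerProductGeometry.angle x y < α / 2}) fun x hx => by
      have hx0 : x ≠ 0 := by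
        rintro rfl
        simp at hx
      have hc : ContinuousAt (fun y => InnerProductGeometry.angle x y) x :=
        (InnerProductGeometry.continuousAt_angle (x := (x, x)) hx0 hx0).comp
          (f := fun y => (x, y)) (by fun_prop)
      refine hc.eventually_lt continuousAt_const ?_
      rw [InnerProductGeometry.angle_self hx0]
      linarith
  refine ⟨F.card, fun T hT0 hT => ?_⟩
  have hcap : ∀ v ∈ T, ∃ x ∈ F, InnerProductGeometry.angle x v < α / 2 := by
    intro v hv
    have hv0 := norm_pos_iff.2 (hT0 v hv)
    have hmem : ‖v‖⁻¹ • v ∈ Metric.sphere (0 : V) 1 := by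
      simp [norm_smul, hv0.ne']
    obtain ⟨x, hx, hxv⟩ := Set.mem_iUnion₂.1 (hcover hmem)
    refine ⟨x, hx, ?_⟩
    rwa [Set.mem_ofPred_eq, InnerProductGeometry.angle_smul_right_of_pos _ _ (inv_pos.2 hv0)] at hxv
  choose! f hfF hf using hcap
  refine Finset.card_le_card_of_injOn f hfF fun v hv w hw hvw => ?_
  by_contra hne
  have h1 := hf v hv
  have h2 := hf w hw
  rw [← hvw] at h2
  rw [InnerProductGeometry.angle_comm] at h1
  linarith [hT v hv w hw hne, InnerProductGeometry.angle_le_angle_add_angle v (f v) w]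

/-- Two out-neighbours of `p` at different distances include an angle of at least `α`, because the
closer one excludes the other. -/
theorem le_angle_of_ssgAdj {d : ℕ} {S : Finset (Euc d)} {α : ℝ} {p q r : Euc d}
    (hq : SSGAdj S α p q) (hr : SSGAdj S α p r) (hne : dist p q ≠ dist p r) :
    α ≤ EuclideanGeometry.angle q p r := by
  by_contra! h
  have hq' := ssgAdj_iff_forall.1 hq
  have hr' := ssgAdj_iff_forall.1 hr
  rcases hne.lt_or_gt with hlt | hlt
  · exact hr'.2.2.2 q hq'.2.1 h hlt hq
  · exact hq'.2.2.2 r hr'.2.1 (by rwa [EuclideanGeometry.angle_comm]) hlt hr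

theorem exists_ssgDegree_le (d : ℕ) {α : ℝ} (hα : 0 < α) :
    ∃ N : ℕ, ∀ S : Finset (Euc d),
      (∀ a ∈ S, ∀ b ∈ S, ∀ c ∈ S, b ≠ a → b ≠ c → dist a b ≠ dist a c) → ssgDegree S α ≤ N := by
  classical
  obtain ⟨N, hN⟩ := exists_card_le_of_angle_le (V := Euc d) hα
  refine ⟨N, fun S hS => Finset.sup_le fun p hp => ?_⟩
  have hinj : Function.Injective fun q : Euc d => q - p := sub_left_injective
  rw [ssgOutDegree, ← Finset.card_image_of_injective _ hinj]
  apply hN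
  · intro v hv
    obtain ⟨q, hq, rfl⟩ := Finset.mem_image.1 hv
    exact sub_ne_zero.2 (ssgAdj_iff_forall.1 (Finset.mem_filter.1 hq).2).2.2.1
  · intro v hv w hw hvw
    obtain ⟨q, hq, rfl⟩ := Finset.mem_image.1 hv
    obtain ⟨r, hr, rfl⟩ := Finset.mem_image.1 hw
    obtain ⟨hqS, hq⟩ := Finset.mem_filter.1 hq
    obtain ⟨hrS, hr⟩ := Finset.mem_filter.1 hr
    have hqr : q ≠ r := fun h => hvw (by rw [h])
    exact le_angle_of_ssgAdj hq hr
      (hS p hp q hqS r hrS (ssgAdj_iff_forall.1 hq).2.2.1 hqr)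

/-! ### Greedy search -/

/-- Properties kept by the iterations of a search in `S` with out-degrees at most `D`: all nodes
in use belong to `S`, the neighbours of checked nodes have been visited, the first node of the pool
is at least as close to the query as all nodes visited so far, and each checked node has
contributed at most `1 + D` to the cost. -/
structure SearchInvariant {V : Type} [Dist V] (S : Finset V) (nbrs : V → List V) (q : V) (D : ℕ)
    (s : SearchState V) : Prop where
  pool_subset : ∀ v ∈ s.pool, v ∈ S
  checked_subset : s.checked ⊆ (S : Set V)
  mem_visited : ∀ p ∈ s.checked, ∀ v ∈ nbrs p, v ∈ s.visited
  exists_head : ∃ h, s.pool.head? = some h ∧ ∀ v ∈ s.visited, dist h q ≤ dist v q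
  cost_le : s.cost ≤ 1 + s.checked.ncard * (1 + D)

theorem searchInvariant_searchInit {V : Type} [Dist V] {S : Finset V} (nbrs : V → List V) (q : V)
    (D : ℕ) {p : V} (hp : p ∈ S) : SearchInvariant S nbrs q D (searchInit p) where
  pool_subset := by simpa [searchInit] using hp
  checked_subset := by simp [searchInit]
  mem_visited := by simp [searchInit]
  exists_head := ⟨p, by simp [searchInit]⟩
  cost_le := by simp [searchInit]

/-- Cutting a non-empty pool down to its `l ≥ 1` closest nodes keeps a closest node in front. -/
theorem exists_head_take_insertionSort {V : Type} {f : V → ℝ}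
    [DecidableRel fun a b : V => f a ≤ f b] {l : ℕ} (hl : 1 ≤ l) {L : List V} (hL : L ≠ []) :
    ∃ h, ((L.insertionSort fun a b => f a ≤ f b).take l).head? = some h ∧
      ∀ v ∈ L, f h ≤ f v := by
  have : Std.Total fun a b : V => f a ≤ f b := ⟨fun a b => le_total _ _⟩
  have : IsTrans V fun a b : V => f a ≤ f b := ⟨fun a b c => le_trans⟩
  have hsort := List.pairwise_insertionSort (fun a b : V => f a ≤ f b) L
  have hmem : ∀ v, v ∈ L.insertionSort (fun a b : V => f a ≤ f b) ↔ v ∈ L := fun v =>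
    List.mem_insertionSort _
  cases hM : L.insertionSort (fun a b : V => f a ≤ f b) with
  | nil =>
    obtain ⟨v, hv⟩ := List.exists_mem_of_ne_nil L hL
    have := (hmem v).2 hv
    rw [hM] at this
    simp at this
  | cons h M =>
    obtain ⟨m, rfl⟩ : ∃ m, l = m + 1 := ⟨l - 1, by omega⟩
    refine ⟨h, by simp, fun v hv => ?_⟩
    have hv' := (hmem v).2 hv
    rw [hM] at hv' hsort
    rcases List.mem_cons.1 hv' with rfl | hv'
    · exact le_rfl
    · exact (List.pairwise_cons.1 hsort).1 v hv'

/-- If there is an unchecked node in the pool, an iteration checks a new node of `S` and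
keeps the invariant. -/
theorem SearchInvariant.searchStep {V : Type} [Dist V] {S : Finset V} {nbrs : V → List V} {q : V}
    {D l : ℕ} (hl : 1 ≤ l) (hS : ∀ p ∈ S, ∀ v ∈ nbrs p, v ∈ S)
    (hD : ∀ p ∈ S, (nbrs p).length ≤ D) {s : SearchState V} (hs : SearchInvariant S nbrs q D s)
    (hex : ∃ v ∈ s.pool, v ∉ s.checked) :
    SearchInvariant S nbrs q D (searchStep nbrs q l s) ∧
      (_root_.searchStep nbrs q l s).checked.ncard = s.checked.ncard + 1 := by
  classical
  cases hfind : s.pool.find? (fun v => decide (v ∉ s.checked)) with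
  | none =>
    obtain ⟨v, hv, hvc⟩ := hex
    simpa [hvc] using List.find?_eq_none.1 hfind v hv
  | some p =>
    have hp : p ∈ s.pool := List.mem_of_find?_eq_some hfind
    have hpS := hs.pool_subset p hp
    have hpc : p ∉ s.checked := by simpa using List.find?_some hfind
    have hcard : (insert p s.checked).ncard = s.checked.ncard + 1 :=
      Set.ncard_insert_of_notMem hpc (S.finite_toSet.subset hs.checked_subset)
    have hstep : _root_.searchStep nbrs q l s =
        { pool := ((s.pool ++ (nbrs p).filter (fun v => decide (v ∉ s.visited))).insertionSort
            (fun a b => dist a q ≤ dist b q)).take l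
          checked := insert p s.checked
          visited := s.visited ∪ {v | v ∈ nbrs p}
          cost := s.cost + 1 + (nbrs p).length } := by
      -- The decidability instances inside `searchStep` differ from the ones in scope.
      unfold _root_.searchStep
      split
      · rename_i h
        have := h.symm.trans ((by congr!) : _ = _) |>.trans hfind
        simp at this
      · rename_i p' h
        have := h.symm.trans ((by congr!) : _ = _) |>.trans hfind
        obtain rfl : p' = p := by simpa using this
        congr!
    rw [hstep]
    refine ⟨⟨?_, ?_, ?_, ?_, ?_⟩, hcard⟩
    · intro v hv
      have hv := (List.mem_insertionSort _).1 (List.mem_of_mem_take hv)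
      rcases List.mem_append.1 hv with hv | hv
      · exact hs.pool_subset v hv
      · exact hS p hpS v (List.mem_filter.1 hv).1
    · exact Set.insert_subset hpS hs.checked_subset
    · rintro p' (rfl | hp') v hv
      · exact Or.inr hv
      · exact Or.inl (hs.mem_visited p' hp' v hv)
    · obtain ⟨h, hh, hmin⟩ := hs.exists_head
      obtain ⟨h', hh', hmin'⟩ := exists_head_take_insertionSort (f := fun v => dist v q) hl
        (List.append_ne_nil_of_left_ne_nil (List.ne_nil_of_mem hp)
          ((nbrs p).filter (fun v => decide (v ∉ s.visited))))
      refine ⟨h', hh', ?_⟩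
      have hvis : ∀ v ∈ s.visited, dist h' q ≤ dist v q := fun v hv =>
        (hmin' h (List.mem_append_left _ (List.mem_of_mem_head? hh))).trans (hmin v hv)
      rintro v (hv | hv)
      · exact hvis v hv
      · by_cases hvv : v ∈ s.visited
        · exact hvis v hvv
        · exact hmin' v (List.mem_append_right _ (List.mem_filter.2 ⟨hv, by simpa using hvv⟩))
    · have h1 := hs.cost_le
      have h2 := hD p hpS
      simp only [hcard]
      linarith

/-- Since each iteration checks a new node, the search stops. -/
theorem SearchInvariant.exists_all_checked {V : Type} [Dist V] {S : Finset V} {nbrs : V → List V} {q : V}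
    {D l : ℕ} (hl : 1 ≤ l) (hS : ∀ p ∈ S, ∀ v ∈ nbrs p, v ∈ S)
    (hD : ∀ p ∈ S, (nbrs p).length ≤ D) :
    ∀ (k : ℕ) (s : SearchState V), SearchInvariant S nbrs q D s →
      S.card ≤ s.checked.ncard + k →
      ∃ t : ℕ, SearchInvariant S nbrs q D ((_root_.searchStep nbrs q l)^[t] s) ∧
        ∀ v ∈ ((_root_.searchStep nbrs q l)^[t] s).pool,
          v ∈ ((_root_.searchStep nbrs q l)^[t] s).checked := by
  intro k
  induction k with
  | zero =>
    intro s hs hk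
    refine ⟨0, hs, fun v hv => ?_⟩
    have : s.checked = (S : Set V) :=
      Set.eq_of_subset_of_ncard_le hs.checked_subset (by simpa using hk)
    simpa [this] using hs.pool_subset v hv
  | succ k ih =>
    intro s hs hk
    by_cases hex : ∃ v ∈ s.pool, v ∉ s.checked
    · obtain ⟨hs', hcard⟩ := hs.searchStep hl hS hD hex
      obtain ⟨t, ht⟩ := ih _ hs' (by omega)
      exact ⟨t + 1, by simpa only [Function.iterate_succ_apply] using ht⟩
    · push Not at hex
      exact ⟨0, hs, hex⟩

/-- On a graph in which every node other than the query has a neighbour closer to the query, the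
search finds the query, and checks each node at most once. -/
theorem exists_searchReturns {V : Type} [Dist V] {S : Finset V} {nbrs : V → List V} {q : V}
    {D l : ℕ} (hl : 1 ≤ l) (hS : ∀ p ∈ S, ∀ v ∈ nbrs p, v ∈ S)
    (hD : ∀ p ∈ S, (nbrs p).length ≤ D)
    (hmono : ∀ p ∈ S, p ≠ q → ∃ r ∈ nbrs p, dist r q < dist p q) {p : V} (hp : p ∈ S) :
    ∃ c : ℕ, SearchReturns nbrs q l p q c ∧ c ≤ 1 + S.card * (1 + D) := by
  obtain ⟨t, hs, hchecked⟩ := SearchInvariant.exists_all_checked hl hS hD S.card (searchInit p)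
    (searchInvariant_searchInit nbrs q D hp) (Nat.le_add_left _ _)
  obtain ⟨h, hh, hmin⟩ := hs.exists_head
  have hmem := List.mem_of_mem_head? hh
  have hq : h = q := by
    by_contra hne
    obtain ⟨r, hr, hlt⟩ := hmono h (hs.pool_subset h hmem) hne
    exact absurd hlt (not_lt.2 (hmin r (hs.mem_visited h (hchecked h hmem) r hr)))
  refine ⟨_, ⟨t, hchecked, hq ▸ hh, rfl⟩, hs.cost_le.trans ?_⟩
  have hcard := Set.ncard_le_ncard hs.checked_subset S.finite_toSet
  rw [Set.ncard_coe_finset] at hcard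
  gcongr

/-! ### The size of the triangle gap -/

/-- Reals in `[0, M]` at pairwise distance at least `ε` occupy disjoint cells of length `ε`. -/
theorem card_sub_one_mul_le {T : Finset ℝ} {M ε : ℝ} (hε : 0 < ε) (hM : 0 ≤ M)
    (hT : ∀ t ∈ T, 0 ≤ t ∧ t ≤ M) (hsep : ∀ s ∈ T, ∀ t ∈ T, s ≠ t → ε ≤ |s - t|) :
    ((T.card : ℝ) - 1) * ε ≤ M := by
  have hcard : T.card ≤ (Finset.range (⌊M / ε⌋₊ + 1)).card := by
    refine Finset.card_le_card_of_injOn (fun t => ⌊t / ε⌋₊) (fun t ht => ?_)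
      fun s hs t ht hst => ?_
    · have := Nat.floor_le_floor (div_le_div_of_nonneg_right (hT t ht).2 hε.le)
      simpa [Nat.lt_succ_iff] using this
    · by_contra hne
      have h1 := Nat.floor_le (div_nonneg (hT s hs).1 hε.le)
      have h2 := Nat.lt_floor_add_one (s / ε)
      have h3 := Nat.floor_le (div_nonneg (hT t ht).1 hε.le)
      have h4 := Nat.lt_floor_add_one (t / ε)
      simp only at hst
      rw [hst] at h1 h2
      have h5 : |s / ε - t / ε| < 1 := abs_lt.2 ⟨by linarith, by linarith⟩
      rw [← sub_div, abs_div, abs_of_pos hε, div_lt_one hε] at h5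
      exact absurd (hsep s hs t ht hne) (not_le.2 h5)
  rw [Finset.card_range] at hcard
  have h1 : (T.card : ℝ) ≤ ⌊M / ε⌋₊ + 1 := by exact_mod_cast hcard
  have h2 := Nat.floor_le (div_nonneg hM hε.le)
  rw [← le_div_iff₀ hε]
  linarith

/-- The values over which the infimum in `triangleGap` is taken. -/
def triangleGapSet {d : ℕ} (S : Finset (Euc d)) : Set ℝ :=
  {t | ∃ a ∈ S, ∃ b ∈ S, ∃ c ∈ S, a ≠ b ∧ a ≠ c ∧ b ≠ c ∧
    dist a b ≠ dist a c ∧ dist a b ≠ dist b c ∧ dist a c ≠ dist b c ∧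
    t = |dist a b - dist a c|}

theorem finite_triangleGapSet {d : ℕ} (S : Finset (Euc d)) : (triangleGapSet S).Finite := by
  refine ((S ×ˢ S ×ˢ S).finite_toSet.image
    fun x : Euc d × Euc d × Euc d => |dist x.1 x.2.1 - dist x.1 x.2.2|).subset ?_
  rintro t ⟨a, ha, b, hb, c, hc, -, -, -, -, -, -, rfl⟩
  exact ⟨(a, b, c), by simp [ha, hb, hc], rfl⟩

theorem triangleGap_le {d : ℕ} {S : Finset (Euc d)}
    (hS : ∀ a ∈ S, ∀ b ∈ S, ∀ c ∈ S, b ≠ a → b ≠ c → dist a b ≠ dist a c) {a b c : Euc d}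
    (ha : a ∈ S) (hb : b ∈ S) (hc : c ∈ S) (hab : b ≠ a) (hac : c ≠ a) (hbc : b ≠ c) :
    triangleGap S ≤ |dist a b - dist a c| := by
  refine csInf_le (finite_triangleGapSet S).bddBelow
    ⟨a, ha, b, hb, c, hc, hab.symm, hac.symm, hbc, hS a ha b hb c hc hab hbc, ?_, ?_, rfl⟩
  · rw [dist_comm a b]
    exact hS b hb a ha c hc hab.symm hac.symm
  · rw [dist_comm a c, dist_comm b c]
    exact hS c hc a ha b hb hac.symm hab.symm

theorem triangleGap_pos {d : ℕ} {S : Finset (Euc d)}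
    (hS : ∀ a ∈ S, ∀ b ∈ S, ∀ c ∈ S, b ≠ a → b ≠ c → dist a b ≠ dist a c) (hcard : 3 ≤ S.card) :
    0 < triangleGap S := by
  obtain ⟨a, ha, b, hb, c, hc, hab, hac, hbc⟩ := Finset.two_lt_card.1 hcard
  have hne : (triangleGapSet S).Nonempty := by
    refine ⟨_, a, ha, b, hb, c, hc, hab, hac, hbc, hS a ha b hb c hc hab.symm hbc, ?_, ?_, rfl⟩
    · rw [dist_comm a b]
      exact hS b hb a ha c hc hab hac
    · rw [dist_comm a c, dist_comm b c]
      exact hS c hc a ha b hb hac hab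
  obtain ⟨a, -, b, -, c, -, -, -, -, h, -, -, heq⟩ := hne.csInf_mem (finite_triangleGapSet S)
  rw [triangleGapSet] at heq
  rw [triangleGap, heq]
  exact abs_pos.2 (sub_ne_zero.2 h)

/-- The distances from one point to the `n - 1` others lie in `[0, M]` and differ pairwise by at least
the gap, so that the gap is at most `M / (n - 2)`, which is at most `3 * M / n` as `n ≥ 3`. -/
theorem card_mul_triangleGap_le {d : ℕ} {S : Finset (Euc d)}
    (hS : ∀ a ∈ S, ∀ b ∈ S, ∀ c ∈ S, b ≠ a → b ≠ c → dist a b ≠ dist a c) (hcard : 3 ≤ S.card)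
    {M : ℝ} (hM : ∀ a ∈ S, ∀ b ∈ S, dist a b ≤ M) : S.card * triangleGap S ≤ 3 * M := by
  classical
  have hpos := triangleGap_pos hS hcard
  obtain ⟨a, ha⟩ := Finset.card_pos.1 (by omega : 0 < S.card)
  have hinj : Set.InjOn (dist a) (S.erase a : Finset (Euc d)) := by
    intro b hb c hc hbc
    by_contra hne
    obtain ⟨hba, hb⟩ := Finset.mem_erase.1 hb
    exact hS a ha b hb c (Finset.mem_erase.1 hc).2 hba hne hbc
  have h0 : 0 ≤ M := dist_nonneg.trans (hM a ha a ha)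
  have key := card_sub_one_mul_le (T := (S.erase a).image (dist a)) hpos h0 ?_ ?_
  · rw [Finset.card_image_of_injOn hinj, Finset.card_erase_of_mem ha,
      Nat.cast_sub (by omega)] at key
    have h3 : (3 : ℝ) ≤ S.card := by exact_mod_cast hcard
    push_cast at key
    nlinarith
  · intro t ht
    obtain ⟨b, hb, rfl⟩ := Finset.mem_image.1 ht
    exact ⟨dist_nonneg, hM a ha b (Finset.mem_erase.1 hb).2⟩
  · intro s hs t ht hst
    obtain ⟨b, hb, rfl⟩ := Finset.mem_image.1 hs
    obtain ⟨c, hc, rfl⟩ := Finset.mem_image.1 ht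
    obtain ⟨hba, hb⟩ := Finset.mem_erase.1 hb
    obtain ⟨hca, hc⟩ := Finset.mem_erase.1 hc
    exact triangleGap_le hS ha hb hc hba hca fun h => hst (by rw [h])

/-- The diameter of the region is at most a constant times `n ^ (1 / d)`. -/
theorem IsRandomDataset.diam_le {d n : ℕ} (hd : 0 < d) {κ g : ℝ} (hκ : 0 < κ) (hg : 0 < g)
    {Ω : Set (Euc d)} {μ : Measure (Fin n → Euc d)} (h : IsRandomDataset κ g Ω μ) :
    Metric.diam Ω ≤ (κ / (g * (volume (Metric.ball (0 : Euc d) 1)).toReal)) ^ (1 / (d : ℝ)) *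
      (n : ℝ) ^ (1 / (d : ℝ)) := by
  have hv : 0 < (volume (Metric.ball (0 : Euc d) 1)).toReal :=
    ENNReal.toReal_pos (Metric.measure_ball_pos volume _ one_pos).ne' measure_ball_lt_top.ne
  set v := (volume (Metric.ball (0 : Euc d) 1)).toReal with hv_def
  have : Nonempty (Fin d) := ⟨⟨0, hd⟩⟩
  have hfin : volume Ω ≠ ⊤ := h.isBounded.measure_lt_top.ne
  have h1 : Metric.diam Ω ^ d * v ≤ κ * (volume Ω).toReal := by
    have := ENNReal.toReal_mono (ENNReal.mul_ne_top ENNReal.ofReal_ne_top hfin) h.volume_ball_le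
    rw [Measure.addHaar_ball _ _ Metric.diam_nonneg, ENNReal.toReal_mul, ENNReal.toReal_mul,
      ENNReal.toReal_ofReal (by positivity), ENNReal.toReal_ofReal hκ.le] at this
    simpa using this
  have h2 : g * (volume Ω).toReal ≤ n := by
    have := ENNReal.toReal_mono (ENNReal.natCast_ne_top n) h.density_le
    rw [ENNReal.toReal_mul, ENNReal.toReal_ofReal hg.le] at this
    simpa using this
  have h3 : Metric.diam Ω ^ d ≤ κ / (g * v) * n := by
    rw [div_mul_eq_mul_div, le_div_iff₀ (mul_pos hg hv)]
    nlinarith [mul_le_mul_of_nonneg_left h1 hg.le, mul_le_mul_of_nonneg_left h2 hκ.le]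
  rw [← Real.mul_rpow (by positivity) (by positivity), one_div,
    Real.le_rpow_inv_iff_of_pos Metric.diam_nonneg (by positivity) (by positivity)]
  simpa using h3

/-! ### The complexity of the search -/

/-- Arithmetic of the final estimate: a cost of order `D * n` is of order `D * A * m / gap` as soon
as `n * gap ≤ 3 * A * m`, and the logarithm is bounded below by `1 / d`. -/
theorem cost_le_of_card_mul_le {c n D d : ℕ} {A m gap : ℝ} (hd : 0 < d) (hn : 1 ≤ n) (hD : 1 ≤ D)
    (hA : 0 < A) (hm : 0 ≤ m) {L : ℝ} (hL : 1 / (d : ℝ) ≤ L) (hgap : 0 < gap)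
    (hc : c ≤ 1 + n * (1 + D)) (h : n * gap ≤ 3 * (A * m)) :
    (c : ℝ) ≤ 9 * A * d * (D * m * L / gap) := by
  have hd' : (0 : ℝ) < d := by exact_mod_cast hd
  have h1 : (c : ℝ) ≤ 3 * n * D := by
    have : c ≤ 3 * n * D := by nlinarith [Nat.mul_le_mul hn hD]
    exact_mod_cast this
  have h2 : (n : ℝ) ≤ 3 * (A * m) / gap := (le_div_iff₀ hgap).2 h
  have h3 : 1 ≤ d * L := by
    rw [div_le_iff₀ hd'] at hL
    linarith
  calc (c : ℝ) ≤ 3 * n * D := h1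
    _ ≤ 3 * (3 * (A * m) / gap) * D := by gcongr
    _ = 9 * A * (D * m / gap) * 1 := by ring
    _ ≤ 9 * A * (D * m / gap) * (d * L) := by gcongr
    _ = 9 * A * d * (D * m * L / gap) := by ring

theorem one_div_le_log_rpow {n : ℕ} (hn : 3 ≤ n) (d : ℕ) :
    1 / (d : ℝ) ≤ Real.log ((n : ℝ) ^ (1 / (d : ℝ))) := by
  have h3 : (3 : ℝ) ≤ n := by exact_mod_cast hn
  rw [Real.log_rpow (by linarith)]
  have : 1 ≤ Real.log n := by
    rw [Real.le_log_iff_exp_le (by linarith)]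
    linarith [Real.exp_one_lt_d9]
  exact le_mul_of_one_le_right (by positivity) this

theorem theorem2 (d : ℕ) (hd : 0 < d) :
    ∃ D : ℝ → ℕ, ∀ κ g : ℝ, 0 < κ → 0 < g → ∃ C : ℝ, 0 < C ∧
      ∀ (n : ℕ), 3 ≤ n → ∀ (Ω : Set (Euc d)) (μ : Measure (Fin n → Euc d)),
        IsRandomDataset κ g Ω μ →
        ∀ᵐ x ∂μ, ∀ S : Finset (Euc d), (S : Set (Euc d)) = Set.range x →
          ∀ α : ℝ, 0 ≤ α → α ≤ Real.pi / 3 →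
            (0 < α → ssgDegree S α ≤ D α) ∧
            ∀ nbrs : Euc d → List (Euc d), IsSSGAdjacencyList S α nbrs →
              ∀ l : ℕ, 1 ≤ l → ∀ q ∈ S, ∃ c : Euc d → ℕ,
                (∀ p ∈ S, SearchReturns nbrs q l p q (c p)) ∧
                (∀ p ∈ S, (c p : ℝ) ≤ C * ((ssgDegree S α : ℝ) * (n : ℝ) ^ (1 / (d : ℝ)) *
                  Real.log ((n : ℝ) ^ (1 / (d : ℝ))) / triangleGap S)) ∧
                (∑ p ∈ S, (c p : ℝ)) / (S.card : ℝ) ≤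
                  C * ((ssgDegree S α : ℝ) * (n : ℝ) ^ (1 / (d : ℝ)) *
                    Real.log ((n : ℝ) ^ (1 / (d : ℝ))) / triangleGap S) := by
  have hdeg : ∀ α : ℝ, ∃ N : ℕ, 0 < α → ∀ S : Finset (Euc d),
      (∀ a ∈ S, ∀ b ∈ S, ∀ c ∈ S, b ≠ a → b ≠ c → dist a b ≠ dist a c) →
        ssgDegree S α ≤ N := fun α => by
    by_cases hα : 0 < α
    · obtain ⟨N, hN⟩ := exists_ssgDegree_le d hα
      exact ⟨N, fun _ => hN⟩
    · exact ⟨0, fun h => absurd h hα⟩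
  choose D hD using hdeg
  refine ⟨D, fun κ g hκ hg => ?_⟩
  have hv : 0 < (volume (Metric.ball (0 : Euc d) 1)).toReal :=
    ENNReal.toReal_pos (Metric.measure_ball_pos volume _ one_pos).ne' measure_ball_lt_top.ne
  set A := (κ / (g * (volume (Metric.ball (0 : Euc d) 1)).toReal)) ^ (1 / (d : ℝ)) with hA_def
  have hA : 0 < A := by positivity
  refine ⟨9 * A * d, by positivity, fun n hn Ω μ hμ => ?_⟩
  filter_upwards [ae_dist_ne_dist hd hμ.absolutelyContinuous, hμ.ae_mem] with x hx hxΩ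
  intro S hSx α _ hα
  have hmem : ∀ {a}, a ∈ S ↔ ∃ i, x i = a := fun {a} => by
    rw [← Finset.mem_coe, hSx, Set.mem_range]
  have hS : ∀ a ∈ S, ∀ b ∈ S, ∀ c ∈ S, b ≠ a → b ≠ c → dist a b ≠ dist a c := by
    intro a ha b hb c hc hba hbc
    obtain ⟨i, rfl⟩ := hmem.1 ha
    obtain ⟨j, rfl⟩ := hmem.1 hb
    obtain ⟨k, rfl⟩ := hmem.1 hc
    exact hx i j k (fun h => hba (by rw [h])) fun h => hbc (by rw [h])
  have hcard : S.card = n := by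
    have hinj : Function.Injective x := by
      intro i j hij
      by_contra hne
      exact hx i j i (Ne.symm hne) (Ne.symm hne) (by rw [hij])
    rw [← Set.ncard_coe_finset, hSx, ← Set.image_univ, Set.ncard_image_of_injective _ hinj]
    simp
  have hdiam : ∀ a ∈ S, ∀ b ∈ S, dist a b ≤ A * (n : ℝ) ^ (1 / (d : ℝ)) := by
    intro a ha b hb
    obtain ⟨i, rfl⟩ := hmem.1 ha
    obtain ⟨j, rfl⟩ := hmem.1 hb
    exact (Metric.dist_le_diam_of_mem hμ.isBounded (hxΩ i) (hxΩ j)).trans (hμ.diam_le hd hκ hg)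
  have hcard3 : 3 ≤ S.card := hcard ▸ hn
  have hgap := card_mul_triangleGap_le hS hcard3 hdiam
  rw [hcard] at hgap
  refine ⟨fun hα0 => hD α hα0 S hS, fun nbrs hnbrs l hl q hq => ?_⟩
  have hsearch : ∀ p ∈ S, ∃ c : ℕ, SearchReturns nbrs q l p q c ∧
      c ≤ 1 + S.card * (1 + ssgDegree S α) := fun p hp => by
    refine exists_searchReturns hl (fun p hp v hv => ?_) (fun p hp => hnbrs.length_le hp)
      (fun p hp hpq => ?_) hp
    · exact (ssgAdj_iff_forall.1 (((hnbrs p hp).2 v).1 hv)).2.1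
    · obtain ⟨r, hr, hlt⟩ := exists_ssgAdj_dist_lt hα hp hq hpq
      exact ⟨r, ((hnbrs p hp).2 r).2 hr, hlt⟩
  choose! c hret hcost using hsearch
  have hbound : ∀ p ∈ S, (c p : ℝ) ≤ 9 * A * d * ((ssgDegree S α : ℝ) *
      (n : ℝ) ^ (1 / (d : ℝ)) * Real.log ((n : ℝ) ^ (1 / (d : ℝ))) / triangleGap S) :=
    fun p hp => cost_le_of_card_mul_le hd (by omega) (one_le_ssgDegree hα (by omega)) hA
      (by positivity) (one_div_le_log_rpow hn d) (triangleGap_pos hS hcard3)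
      (hcard ▸ hcost p hp) hgap
  refine ⟨c, hret, hbound, ?_⟩
  rw [div_le_iff₀ (by exact_mod_cast (by omega : 0 < S.card)), mul_comm]
  simpa using Finset.sum_le_card_nsmul S (fun p => (c p : ℝ)) _ hbound
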